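/- Let $n\ge 1$ and let $A\in\mathbb{C}^{n\times n}$ have spectral abscissa $\alpha(A)=\max\{\operatorname{Re}\lambda:\lambda\in\Lambda(A)\}<0$. Let $$\mathcal{K}(A)=\sup_{z\in\mathbb{C},\ \operatorname{Re}z>0}(\operatorname{Re}z)\,\|(zI-A)^{-1}\|_2$$ be its continuous-time Kreiss constant, and for $x>0$, $y\in\mathbb{R}$ put $$g(x,y)=\sigma_{\min}\!\left(\frac{(x+\mathrm{i}y)I-A}{x}\right),$$ where $\sigma_{\min}$ is the smallest singular value. Let $\gamma\in[0,1)$, let $\eta\ge 0$, and let $(x_\star,y_\star)$ with $x_\star>0$ be a global minimizer of $g$ over $\{(x,y):x>0,\ y\in\mathbb{R}\}$. Then: 1. If $\mathcal{K}(A)^{-1}\le\gamma$ and $\eta\le 2x_\star(\gamma-\mathcal{K}(A)^{-1})$, then there exist $x>0$ and $y\in\mathbb{R}$ such that $g(x,y)=g(x,y+\eta)=\gamma$. 2. If there do not exist $x>0$ and $y\in\mathbb{R}$ such that $g(x,y)=g(x,y+\eta)=\gamma$, then $\mathcal{K}(A)^{-1}>\gamma-\dfrac{\eta}{2x_\star}$.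 -/

import Mathlib

noncomputable section

/-- The spectral abscissa `α(A) = max {Re λ : λ ∈ Λ(A)}` of a complex square matrix. -/
def spectralAbscissa {n : ℕ} (A : Matrix (Fin n) (Fin n) ℂ) : ℝ :=
  sSup (Complex.re '' spectrum ℂ A)

/-- The matrix 2-norm, i.e. the operator norm for the Euclidean norm on `ℂⁿ`. -/
def norm2 {n : ℕ} (M : Matrix (Fin n) (Fin n) ℂ) : ℝ :=
  ‖Matrix.toEuclideanCLM (n := Fin n) (𝕜 := ℂ) M‖

/-- The smallest singular value `σ_min(M)` of an `n × n` matrix. Mathlib's singular values are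
indexed from `0` and listed in descending order with multiplicity, so it is the one of
index `n - 1` (for `n ≥ 1`). -/
def sigmaMin {n : ℕ} (M : Matrix (Fin n) (Fin n) ℂ) : ℝ :=
  (Matrix.toEuclideanLin M).singularValues (n - 1)

/-- The continuous-time Kreiss constant `K(A) = sup_{Re z > 0} (Re z) ‖(zI - A)⁻¹‖`. For
`α(A) < 0`, the case in which it is used, the matrices `zI - A` are invertible and the supremum
is finite. -/
def kreissConst {n : ℕ} (A : Matrix (Fin n) (Fin n) ℂ) : ℝ :=
  sSup ((fun z : ℂ => z.re * norm2 ((z • (1 : Matrix (Fin n) (Fin n) ℂ) - A)⁻¹)) ''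
    {z : ℂ | 0 < z.re})

/-- `G(x,y) = ((x + iy)I - A) / x`. -/
def kreissG {n : ℕ} (A : Matrix (Fin n) (Fin n) ℂ) (x y : ℝ) : Matrix (Fin n) (Fin n) ℂ :=
  (x : ℂ)⁻¹ • (((x : ℂ) + Complex.I * (y : ℂ)) • (1 : Matrix (Fin n) (Fin n) ℂ) - A)

/-- `g(x,y) = σ_min(G(x,y))`, used for `x > 0`. -/
def kreissFun {n : ℕ} (A : Matrix (Fin n) (Fin n) ℂ) (x y : ℝ) : ℝ :=
  sigmaMin (kreissG A x y)

/-- `(xs, ys)` is a global minimizer of `g` over the open right half-plane `x > 0`, `y ∈ ℝ`. -/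
def IsGlobalKreissMinimizer {n : ℕ} (A : Matrix (Fin n) (Fin n) ℂ) (xs ys : ℝ) : Prop :=
  0 < xs ∧ ∀ x y : ℝ, 0 < x → kreissFun A xs ys ≤ kreissFun A x y

end

/-!
Since `(Re z) ‖(zI - A)⁻¹‖ = 1 / g(x, y)` for `z = x + iy`, the inverse Kreiss constant is the
minimum `g(xs, ys)` (`kreissConst_inv_eq`). As `σ_min` is 1-Lipschitz, `g(xs, ·)` is
`1 / xs`-Lipschitz (`kreissFun_le_add`), so `η ≤ 2 xs (γ - g(xs, ys))` puts the vertical segment of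
length `η` centred at `(xs, ys)` into the sublevel set `{g ≤ γ}`. Both parts of the theorem follow
once the existence of such a segment is known to force two points with `g = γ` at vertical
distance `η`.

This is a fact of plane topology (`exists_vertical_chord`), applied to `g - γ` in the coordinates
`x = exp t`; the sublevel set is compact to the right of every vertical line because `γ < 1`
(`isCompact_kreissFun_le`). Let `K` be the component of the sublevel set containing the segment,
`q` a rightmost point of `K`, `V` the component of `Kᶜ` containing the half-plane to the right
of `q`, `F = Vᶜ` and `B = F ∩ closure V`. On `B` the function equals `γ`. The set `F` is connected
(`isPreconnected_compl_connectedComponentIn_compl`), hence so is `B`, because the plane is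
unicoherent (`isPreconnected_inter_of_isClosed_union_eq_univ`). Let `τ` be the vertical translation
by `η`. The segment shows that `F` meets `τ⁻¹ F`, and `τ q` lies in `closure V`, so by connectedness
some point of `F` is moved by `τ` into `B`. Thus `B` meets `τ F`, while `τ⁻¹ q` lies in `closure V`,
so connectedness of `B` gives a point of `B` that `τ⁻¹` maps into `B`.
-/

/-! ### Plane topology -/

open Set Topology in
/-- Unicoherence of simply connected spaces. If `P ∩ Q` split into disjoint closed parts, a Urysohn
function `u` for them would give the circle-valued map `exp (iπu)` on `P`, `exp (-iπu)` on `Q`.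
A continuous logarithm of it differs from `πu` by a constant on `P` and from `-πu` by a constant
on `Q`; comparing a point with `u = 0` and a point with `u = 1` yields `π = -π`. -/
theorem isPreconnected_inter_of_isClosed_union_eq_univ {X : Type*} [TopologicalSpace X]
    [NormalSpace X] [SimplyConnectedSpace X] [LocallyPathConnectedSpace X] {P Q : Set X}
    (hP : IsClosed P) (hQ : IsClosed Q) (hPc : IsPreconnected P) (hQc : IsPreconnected Q)
    (hPQ : P ∪ Q = univ) : IsPreconnected (P ∩ Q) := by
  classical
  rw [isPreconnected_closed_iff]
  rintro t t' ht ht' hcov ⟨a, haPQ, hat⟩ ⟨b, hbPQ, hbt'⟩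
  by_contra hne
  have hdisj : Disjoint (P ∩ Q ∩ t) (P ∩ Q ∩ t') := by
    rw [Set.disjoint_left]
    exact fun x hx hx' => hne ⟨x, hx.1, hx.2, hx'.2⟩
  obtain ⟨u, hu0, hu1, -⟩ := exists_continuous_zero_one_of_isClosed
    ((hP.inter hQ).inter ht) ((hP.inter hQ).inter ht') hdisj
  have hfr : ∀ x ∈ frontier {x | x ∈ P},
      Circle.exp (Real.pi * u x) = Circle.exp (-(Real.pi * u x)) := by
    intro x hx
    have hxP : x ∈ P := hP.frontier_subset hx
    have hxQ : x ∈ Q := by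
      have hx' : x ∈ closure Pᶜ := by
        rw [← frontier_compl] at hx
        exact frontier_subset_closure hx
      refine closure_minimal (fun z hz => ?_) hQ hx'
      have : z ∈ P ∪ Q := hPQ ▸ mem_univ z
      exact this.resolve_left hz
    rcases hcov ⟨hxP, hxQ⟩ with h | h
    · simp [hu0 ⟨⟨hxP, hxQ⟩, h⟩]
    · rw [hu1 ⟨⟨hxP, hxQ⟩, h⟩, Circle.exp_eq_exp]
      exact ⟨1, by simp; ring⟩
  let φ : C(X, Circle) :=
    ⟨fun x => if x ∈ P then Circle.exp (Real.pi * u x) else Circle.exp (-(Real.pi * u x)),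
      Continuous.if hfr (by fun_prop) (by fun_prop)⟩
  have hφP : ∀ x ∈ P, φ x = Circle.exp (Real.pi * u x) := fun x hx => if_pos hx
  have hφQ : ∀ x ∈ Q, φ x = Circle.exp (-(Real.pi * u x)) := by
    intro x hxQ
    by_cases hxP : x ∈ P
    · rw [hφP x hxP]
      rcases hcov ⟨hxP, hxQ⟩ with h | h
      · simp [hu0 ⟨⟨hxP, hxQ⟩, h⟩]
      · rw [hu1 ⟨⟨hxP, hxQ⟩, h⟩, Circle.exp_eq_exp]
        exact ⟨1, by simp; ring⟩
    · exact if_neg hxP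
  obtain ⟨θ, ⟨-, hθ⟩, -⟩ := Circle.isCoveringMap_exp.existsUnique_continuousMap_lifts φ a 0
    (by rw [hφP a haPQ.1]; simp [hu0 ⟨haPQ, hat⟩])
  have hθ' : ∀ x, Circle.exp (θ x) = φ x := fun x => congrFun hθ x
  have hZ : IsDiscrete (range ((↑) : ℤ → ℝ)) :=
    Int.isClosedEmbedding_coe_real.isInducing.isDiscrete_range
  have key : ∀ (S : Set X) (w : C(X, ℝ)), IsPreconnected S → (∀ x ∈ S, φ x = Circle.exp (w x)) →
      a ∈ S → b ∈ S → θ a - w a = θ b - w b := by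
    intro S w hS hw ha hb
    have hpi : (2 * Real.pi) ≠ 0 := by positivity
    have := hS.constant_of_mapsTo hZ (f := fun x => (θ x - w x) / (2 * Real.pi))
      (by fun_prop) (fun x hx => by
        obtain ⟨m, hm⟩ := Circle.exp_eq_exp.1 ((hθ' x).trans (hw x hx))
        refine ⟨m, ?_⟩
        simp only
        rw [hm]
        field_simp
        ring) ha hb
    simpa [div_left_inj' hpi] using this
  have h1 := key P ⟨fun x => Real.pi * u x, by fun_prop⟩ hPc hφP haPQ.1 hbPQ.1
  have h2 := key Q ⟨fun x => -(Real.pi * u x), by fun_prop⟩ hQc hφQ haPQ.2 hbPQ.2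
  have ha0 : u a = 0 := hu0 ⟨haPQ, hat⟩
  have hb1 : u b = 1 := hu1 ⟨hbPQ, hbt'⟩
  simp only [ContinuousMap.coe_mk, ha0, hb1] at h1 h2
  linarith [Real.pi_pos]

open Set Topology in
/-- If `Vᶜ` were split into disjoint closed sets `A ⊇ K` and `B`, then `Vᶜ ∩ B` would also be open,
since a component of `Kᶜ` meeting it lies in it; so it is empty. -/
theorem isPreconnected_compl_connectedComponentIn_compl {X : Type*} [TopologicalSpace X]
    [PreconnectedSpace X] [LocallyConnectedSpace X] {K : Set X} (hK : IsClosed K)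
    (hKc : IsPreconnected K) (hKne : K.Nonempty) (x : X) :
    IsPreconnected (connectedComponentIn Kᶜ x)ᶜ := by
  set V := connectedComponentIn Kᶜ x with hV
  have hVo : IsOpen V := hK.isOpen_compl.connectedComponentIn
  have hKV : K ⊆ Vᶜ := fun z hz hzV => connectedComponentIn_subset _ _ hzV hz
  have key : ∀ A B : Set X, IsClosed A → IsClosed B → Disjoint A B → Vᶜ ⊆ A ∪ B → K ⊆ A →
      Vᶜ ⊆ A := by
    intro A B hA hB hAB hF hKA
    have hBo : IsOpen (Vᶜ ∩ B) := by
      rw [isOpen_iff_mem_nhds]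
      rintro b ⟨hbV, hb⟩
      have hbK : b ∈ Kᶜ := fun h => disjoint_left.1 hAB (hKA h) hb
      refine Filter.mem_of_superset
        (connectedComponentIn_mem_nhds (hK.isOpen_compl.mem_nhds hbK)) ?_
      have hWV : connectedComponentIn Kᶜ b ⊆ Vᶜ := by
        intro z hz hzV
        apply hbV
        rw [hV, connectedComponentIn_eq hzV, ← connectedComponentIn_eq hz]
        exact mem_connectedComponentIn hbK
      rcases isPreconnected_iff_subset_of_disjoint_closed.1 isPreconnected_connectedComponentIn
        A B hA hB (hWV.trans hF) (by rw [hAB.inter_eq, inter_empty]) with h | h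
      · exact (disjoint_left.1 hAB (h (mem_connectedComponentIn hbK)) hb).elim
      · exact subset_inter hWV h
    rcases isClopen_iff.1 ⟨hVo.isClosed_compl.inter hB, hBo⟩ with h | h
    · exact fun z hz => (hF hz).resolve_right fun hzB => (h ▸ ⟨hz, hzB⟩ : z ∈ (∅ : Set X))
    · obtain ⟨k, hk⟩ := hKne
      exact (disjoint_left.1 hAB (hKA hk) (h ▸ mem_univ k : k ∈ Vᶜ ∩ B).2).elim
  rw [isPreconnected_iff_subset_of_fully_disjoint_closed hVo.isClosed_compl]
  intro A B hA hB hF hAB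
  rcases isPreconnected_iff_subset_of_disjoint_closed.1 hKc A B hA hB (hKV.trans hF)
    (by rw [hAB.inter_eq, inter_empty]) with h | h
  · exact Or.inl (key A B hA hB hAB hF h)
  · exact Or.inr (key B A hB hA hAB.symm (union_comm A B ▸ hF) h)

open Set Topology in
/-- If `f ≤ 0` on a vertical segment of length `η`, then `f` vanishes at both ends of some vertical
segment of length `η`, provided `{f ≤ 0}` is compact to the right of every vertical line. -/
theorem exists_vertical_chord {f : ℝ × ℝ → ℝ} (hf : Continuous f)
    (hcpt : ∀ a, IsCompact ({p : ℝ × ℝ | a ≤ p.1} ∩ {p | f p ≤ 0})) {x y η : ℝ} (hη : 0 ≤ η)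
    (hseg : ∀ s ∈ Icc y (y + η), f (x, s) ≤ 0) :
    ∃ x' y', f (x', y') = 0 ∧ f (x', y' + η) = 0 := by
  have hSc : IsClosed {p : ℝ × ℝ | f p ≤ 0} := isClosed_le hf continuous_const
  have hp0 : (x, y) ∈ {p : ℝ × ℝ | f p ≤ 0} := hseg y ⟨le_rfl, by linarith⟩
  set K := connectedComponentIn {p : ℝ × ℝ | f p ≤ 0} (x, y) with hKdef
  have hK0 : (x, y) ∈ K := mem_connectedComponentIn hp0
  have hKS : K ⊆ {p : ℝ × ℝ | f p ≤ 0} := connectedComponentIn_subset _ _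
  have hKpre : IsPreconnected K := isPreconnected_connectedComponentIn
  have hKcl : IsClosed K := by
    refine isClosed_of_closure_subset ?_
    exact hKpre.closure.subset_connectedComponentIn (subset_closure hK0)
      (closure_minimal hKS hSc)
  have hK1 : (x, y + η) ∈ K := by
    have hpre : IsPreconnected ((fun s : ℝ => (x, s)) '' Icc y (y + η)) :=
      isPreconnected_Icc.image _ (by fun_prop)
    refine hpre.subset_connectedComponentIn ⟨y, ⟨le_rfl, by linarith⟩, rfl⟩ ?_
      ⟨y + η, ⟨by linarith, le_rfl⟩, rfl⟩
    rintro _ ⟨s, hs, rfl⟩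
    exact hseg s hs
  -- A rightmost point `q` of `K`.
  obtain ⟨q, hqK, hqmax⟩ : ∃ q ∈ K, ∀ p ∈ K, p.1 ≤ q.1 := by
    have hc : IsCompact ({p : ℝ × ℝ | x ≤ p.1} ∩ K) := by
      refine (hcpt x).of_isClosed_subset ?_ (inter_subset_inter_right _ hKS)
      exact (isClosed_le continuous_const continuous_fst).inter hKcl
    obtain ⟨q, hq, hmax⟩ := hc.exists_isMaxOn ⟨(x, y), le_refl x, hK0⟩ continuous_fst.continuousOn
    refine ⟨q, hq.2, fun p hp => ?_⟩
    rcases le_total x p.1 with h | h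
    · exact hmax ⟨h, hp⟩
    · exact h.trans hq.1
  -- `V` is the component of the complement of `K` that contains the half-plane right of `q`;
  -- the boundary used below is `Vᶜ ∩ closure V`.
  set V := connectedComponentIn Kᶜ (q.1 + 1, 0) with hVdef
  have hVo : IsOpen V := hKcl.isOpen_compl.connectedComponentIn
  have hHV : Ioi q.1 ×ˢ univ ⊆ V := by
    refine ((convex_Ioi q.1).prod convex_univ).isPreconnected.subset_connectedComponentIn
      (by simp) ?_
    rintro p ⟨hp, -⟩ hpK
    exact absurd (hqmax p hpK) (not_le.2 hp)
  have hclV : ∀ p : ℝ × ℝ, q.1 ≤ p.1 → p ∈ closure V := by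
    intro p hp
    refine closure_mono hHV ?_
    rw [closure_prod_eq, closure_Ioi, closure_univ]
    exact ⟨hp, trivial⟩
  have hKF : K ⊆ Vᶜ := fun z hz hzV => connectedComponentIn_subset _ _ hzV hz
  have hFpre : IsPreconnected Vᶜ :=
    isPreconnected_compl_connectedComponentIn_compl hKcl hKpre ⟨_, hK0⟩ _
  have hcover : Vᶜ ∪ closure V = univ := by
    rw [eq_univ_iff_forall]
    intro z
    by_cases hz : z ∈ V
    · exact Or.inr (subset_closure hz)
    · exact Or.inl hz
  have hBpre : IsPreconnected (Vᶜ ∩ closure V) :=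
    isPreconnected_inter_of_isClosed_union_eq_univ hVo.isClosed_compl isClosed_closure hFpre
      isPreconnected_connectedComponentIn.closure hcover
  have hcover' : ∀ (g : ℝ × ℝ → ℝ × ℝ) (s : Set (ℝ × ℝ)),
      s ⊆ g ⁻¹' Vᶜ ∪ g ⁻¹' closure V := by
    intro g s
    rw [← preimage_union, hcover]
    exact fun _ _ => trivial
  -- A boundary point off `K`, or one with `f < 0`, has a connected neighbourhood lying in `Kᶜ`
  -- or in `K` respectively; but it meets `V`.
  have hzero : ∀ b ∈ Vᶜ ∩ closure V, f b = 0 := by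
    rintro b ⟨hbV, hbcl⟩
    have hmeet : ∀ W ∈ 𝓝 b, (W ∩ V).Nonempty := mem_closure_iff_nhds.1 hbcl
    have hbK : b ∈ K := by
      by_contra hbK
      obtain ⟨z, hzW, hzV⟩ := hmeet _
        (connectedComponentIn_mem_nhds (hKcl.isOpen_compl.mem_nhds hbK))
      apply hbV
      rw [hVdef, connectedComponentIn_eq hzV, ← connectedComponentIn_eq hzW]
      exact mem_connectedComponentIn hbK
    refine le_antisymm (hKS hbK) (not_lt.1 fun hlt => ?_)
    have hnhds : {p : ℝ × ℝ | f p ≤ 0} ∈ 𝓝 b :=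
      Filter.mem_of_superset ((isOpen_lt hf continuous_const).mem_nhds hlt)
        fun p (hp : f p < 0) => hp.le
    obtain ⟨z, hzW, hzV⟩ := hmeet _ (connectedComponentIn_mem_nhds hnhds)
    rw [← connectedComponentIn_eq hbK] at hzW
    exact hKF hzW hzV
  -- `Vᶜ` is connected and meets its translate, and `q` is translated into `closure V`: so a point
  -- of `Vᶜ` is translated onto the boundary.
  obtain ⟨r, hrF, hrB⟩ := isPreconnected_closed_iff.1 hFpre
    ((fun p => (p.1, p.2 + η)) ⁻¹' Vᶜ) ((fun p => (p.1, p.2 + η)) ⁻¹' closure V)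
    (hVo.isClosed_compl.preimage (by fun_prop)) (isClosed_closure.preimage (by fun_prop))
    (hcover' _ _) ⟨(x, y), hKF hK0, hKF hK1⟩ ⟨q, hKF hqK, hclV _ le_rfl⟩
  -- Likewise for the connected boundary and the inverse translation.
  obtain ⟨b, hb, hb'⟩ := isPreconnected_closed_iff.1 hBpre
    ((fun p => (p.1, p.2 - η)) ⁻¹' Vᶜ) ((fun p => (p.1, p.2 - η)) ⁻¹' closure V)
    (hVo.isClosed_compl.preimage (by fun_prop)) (isClosed_closure.preimage (by fun_prop))
    (hcover' _ _) ⟨(r.1, r.2 + η), hrB, by simpa using hrF⟩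
    ⟨q, ⟨hKF hqK, hclV _ le_rfl⟩, hclV _ le_rfl⟩
  exact ⟨b.1, b.2 - η, hzero _ hb', by simpa using hzero _ hb⟩

/-! ### Extremal property of singular values -/

open InnerProductSpace Module in
/-- In an eigenbasis of `T* T`, `‖T v‖² = ∑ λᵢ |vᵢ|²`, and the last eigenvalue is the least. -/
theorem LinearMap.singularValues_mul_norm_le {E F : Type*} [NormedAddCommGroup E]
    [InnerProductSpace ℂ E] [FiniteDimensional ℂ E] [NormedAddCommGroup F] [InnerProductSpace ℂ F]
    [FiniteDimensional ℂ F] (T : E →ₗ[ℂ] F) {n : ℕ} (hE : finrank ℂ E = n) (hn : 1 ≤ n) (v : E) :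
    T.singularValues (n - 1) * ‖v‖ ≤ ‖T v‖ := by
  set hS := T.isSymmetric_adjoint_comp_self
  set b := hS.eigenvectorBasis hE
  have h1 : ‖T v‖ ^ 2 = ∑ i, hS.eigenvalues hE i * ‖b.repr v i‖ ^ 2 := by
    have : (‖T v‖ ^ 2 : ℂ) = ⟪v, (adjoint T ∘ₗ T) v⟫_ℂ := by
      rw [LinearMap.comp_apply, LinearMap.adjoint_inner_right, inner_self_eq_norm_sq_to_K]
      rfl
    rw [← b.repr.inner_map_map, PiLp.inner_apply] at this
    simp only [b, hS.eigenvectorBasis_apply_self_apply] at this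
    have h2 := congrArg Complex.re this
    rw [Complex.re_sum] at h2
    rw [show ‖T v‖ ^ 2 = ((‖T v‖ : ℂ) ^ 2).re by norm_cast, h2]
    refine Finset.sum_congr rfl fun i _ => ?_
    simp [b, ← Complex.normSq_eq_norm_sq, Complex.normSq_apply]
    ring
  have h2 : ‖v‖ ^ 2 = ∑ i, ‖b.repr v i‖ ^ 2 := by
    rw [← b.repr.norm_map, EuclideanSpace.norm_sq_eq]
  have h3 : (T.singularValues (n - 1) * ‖v‖) ^ 2 ≤ ‖T v‖ ^ 2 := by
    rw [mul_pow, T.sq_singularValues_of_lt hE (Nat.sub_one_lt (by omega)), h1, h2, Finset.mul_sum]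
    refine Finset.sum_le_sum fun i _ => mul_le_mul_of_nonneg_right ?_ (by positivity)
    exact hS.eigenvalues_antitone hE (Fin.le_def.2 (by have := i.2; simp; omega))
  exact le_of_sq_le_sq h3 (norm_nonneg _)

open InnerProductSpace Module in
theorem LinearMap.exists_norm_eq_singularValues {E F : Type*} [NormedAddCommGroup E]
    [InnerProductSpace ℂ E] [FiniteDimensional ℂ E] [NormedAddCommGroup F] [InnerProductSpace ℂ F]
    [FiniteDimensional ℂ F] (T : E →ₗ[ℂ] F) {i : ℕ} (hi : i < finrank ℂ E) :
    ∃ v, ‖v‖ = 1 ∧ ‖T v‖ = T.singularValues i := by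
  set hS := T.isSymmetric_adjoint_comp_self
  set b := hS.eigenvectorBasis rfl
  refine ⟨b ⟨i, hi⟩, b.norm_eq_one _, ?_⟩
  have h : (‖T (b ⟨i, hi⟩)‖ ^ 2 : ℂ) = hS.eigenvalues rfl ⟨i, hi⟩ := by
    have : (‖T (b ⟨i, hi⟩)‖ ^ 2 : ℂ) = ⟪b ⟨i, hi⟩, (adjoint T ∘ₗ T) (b ⟨i, hi⟩)⟫_ℂ := by
      rw [LinearMap.comp_apply, LinearMap.adjoint_inner_right, inner_self_eq_norm_sq_to_K]
      rfl
    rw [this, hS.apply_eigenvectorBasis, inner_smul_right, inner_self_eq_norm_sq_to_K,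
      b.norm_eq_one]
    simp
  rw [← sq_eq_sq₀ (norm_nonneg _) (T.singularValues_nonneg i), T.sq_singularValues_of_lt rfl hi]
  exact_mod_cast h

/-! ### The smallest singular value of a matrix -/

theorem norm_toEuclideanLin_le {n : ℕ} (M : Matrix (Fin n) (Fin n) ℂ)
    (v : EuclideanSpace ℂ (Fin n)) : ‖Matrix.toEuclideanLin M v‖ ≤ norm2 M * ‖v‖ :=
  (Matrix.toEuclideanCLM (n := Fin n) (𝕜 := ℂ) M).le_opNorm v

theorem norm2_smul_one_le {n : ℕ} (c : ℂ) :
    norm2 (c • (1 : Matrix (Fin n) (Fin n) ℂ)) ≤ ‖c‖ := by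
  rw [norm2, map_smul, map_one, norm_smul]
  exact mul_le_of_le_one_right (norm_nonneg _) ContinuousLinearMap.norm_id_le

theorem sigmaMin_nonneg {n : ℕ} (M : Matrix (Fin n) (Fin n) ℂ) : 0 ≤ sigmaMin M :=
  LinearMap.singularValues_nonneg _ _

theorem sigmaMin_mul_norm_le {n : ℕ} (hn : 1 ≤ n) (M : Matrix (Fin n) (Fin n) ℂ)
    (v : EuclideanSpace ℂ (Fin n)) : sigmaMin M * ‖v‖ ≤ ‖Matrix.toEuclideanLin M v‖ :=
  LinearMap.singularValues_mul_norm_le _ (by simp) hn v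

theorem exists_norm_eq_sigmaMin {n : ℕ} (hn : 1 ≤ n) (M : Matrix (Fin n) (Fin n) ℂ) :
    ∃ v, ‖v‖ = 1 ∧ ‖Matrix.toEuclideanLin M v‖ = sigmaMin M :=
  LinearMap.exists_norm_eq_singularValues _ (by simp; omega)

/-- A pointwise affine bound of `‖M v‖` by `‖N v‖` on the unit sphere passes to the smallest
singular values: test it at a unit vector attaining `σ_min(N)`. -/
theorem sigmaMin_le_of_norm_le {n : ℕ} (hn : 1 ≤ n) {M N : Matrix (Fin n) (Fin n) ℂ} {a b : ℝ}
    (h : ∀ v, ‖v‖ = 1 →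
      ‖Matrix.toEuclideanLin M v‖ ≤ a * ‖Matrix.toEuclideanLin N v‖ + b) :
    sigmaMin M ≤ a * sigmaMin N + b := by
  obtain ⟨v, hv, hv'⟩ := exists_norm_eq_sigmaMin hn N
  rw [← hv']
  refine le_trans ?_ (h v hv)
  simpa [hv] using sigmaMin_mul_norm_le hn M v

theorem sigmaMin_le_add_norm2_sub {n : ℕ} (hn : 1 ≤ n) (M N : Matrix (Fin n) (Fin n) ℂ) :
    sigmaMin M ≤ sigmaMin N + norm2 (M - N) := by
  have := sigmaMin_le_of_norm_le hn (M := M) (N := N) (a := 1) (b := norm2 (M - N)) ?_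
  · simpa using this
  · intro v hv
    have h1 := norm_toEuclideanLin_le (M - N) v
    rw [map_sub, LinearMap.sub_apply, hv, mul_one] at h1
    linarith [norm_le_insert' (Matrix.toEuclideanLin M v) (Matrix.toEuclideanLin N v)]

theorem sigmaMin_smul_le {n : ℕ} (hn : 1 ≤ n) (c : ℂ) (M : Matrix (Fin n) (Fin n) ℂ) :
    sigmaMin (c • M) ≤ ‖c‖ * sigmaMin M := by
  have := sigmaMin_le_of_norm_le hn (M := c • M) (N := M) (a := ‖c‖) (b := 0) ?_
  · simpa using this
  · intro v hv
    rw [map_smul, LinearMap.smul_apply, norm_smul, add_zero]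

theorem sigmaMin_smul {n : ℕ} (hn : 1 ≤ n) {c : ℂ} (hc : c ≠ 0)
    (M : Matrix (Fin n) (Fin n) ℂ) : sigmaMin (c • M) = ‖c‖ * sigmaMin M := by
  refine le_antisymm (sigmaMin_smul_le hn c M) ?_
  have := sigmaMin_smul_le hn c⁻¹ (c • M)
  rw [inv_smul_smul₀ hc, norm_inv] at this
  rwa [inv_mul_eq_div, le_div_iff₀' (norm_pos_iff.2 hc)] at this

/-- An invertible `M` has `σ_min(M) > 0` and `‖M⁻¹‖ = 1 / σ_min(M)`. -/
theorem sigmaMin_pos_and_norm2_inv {n : ℕ} (hn : 1 ≤ n) {M : Matrix (Fin n) (Fin n) ℂ}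
    (hM : IsUnit M) : 0 < sigmaMin M ∧ norm2 M⁻¹ = (sigmaMin M)⁻¹ := by
  have hdet := (Matrix.isUnit_iff_isUnit_det M).1 hM
  have hcomp : ∀ (P Q : Matrix (Fin n) (Fin n) ℂ) v, P * Q = 1 →
      Matrix.toEuclideanLin P (Matrix.toEuclideanLin Q v) = v := by
    intro P Q v h
    have := congrArg (fun R => Matrix.toEuclideanCLM (n := Fin n) (𝕜 := ℂ) R v) h
    rwa [map_mul, map_one] at this
  obtain ⟨v, hv, hv'⟩ := exists_norm_eq_sigmaMin hn M
  have h1 : 1 ≤ norm2 M⁻¹ * sigmaMin M := by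
    have := norm_toEuclideanLin_le M⁻¹ (Matrix.toEuclideanLin M v)
    rwa [hcomp _ _ _ (Matrix.nonsing_inv_mul M hdet), hv, hv'] at this
  have hpos : 0 < sigmaMin M := by
    refine (sigmaMin_nonneg M).lt_of_ne fun h => ?_
    rw [← h, mul_zero] at h1
    linarith
  refine ⟨hpos, le_antisymm ?_ ?_⟩
  · refine ContinuousLinearMap.opNorm_le_bound _ (by positivity) fun w => ?_
    have := sigmaMin_mul_norm_le hn M (Matrix.toEuclideanLin M⁻¹ w)
    rw [hcomp _ _ _ (Matrix.mul_nonsing_inv M hdet)] at this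
    rwa [inv_mul_eq_div, le_div_iff₀' hpos]
  · rwa [inv_eq_one_div, div_le_iff₀ hpos]

/-! ### The shifted matrices `zI - A` -/

theorem isUnit_smul_one_sub {n : ℕ} {A : Matrix (Fin n) (Fin n) ℂ}
    (hA : spectralAbscissa A < 0) {z : ℂ} (hz : 0 < z.re) :
    IsUnit (z • (1 : Matrix (Fin n) (Fin n) ℂ) - A) := by
  by_contra h
  have hmem : z ∈ spectrum ℂ A := by
    rwa [spectrum.mem_iff, Algebra.algebraMap_eq_smul_one]
  have : z.re ≤ spectralAbscissa A :=
    le_csSup (A.finite_spectrum.image _).bddAbove ⟨z, hmem, rfl⟩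
  linarith

theorem sigmaMin_shift_le {n : ℕ} (hn : 1 ≤ n) (A : Matrix (Fin n) (Fin n) ℂ) (z w : ℂ) :
    sigmaMin (z • (1 : Matrix (Fin n) (Fin n) ℂ) - A) ≤
      sigmaMin (w • (1 : Matrix (Fin n) (Fin n) ℂ) - A) + ‖z - w‖ := by
  refine (sigmaMin_le_add_norm2_sub hn _ _).trans (add_le_add_right ?_ _)
  rw [sub_sub_sub_cancel_right, ← sub_smul]
  exact norm2_smul_one_le _

theorem continuous_sigmaMin_shift {n : ℕ} (hn : 1 ≤ n) (A : Matrix (Fin n) (Fin n) ℂ) :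
    Continuous fun z : ℂ => sigmaMin (z • (1 : Matrix (Fin n) (Fin n) ℂ) - A) :=
  (LipschitzWith.of_le_add fun z w => by
    simpa only [dist_eq_norm] using sigmaMin_shift_le hn A z w).continuous

theorem norm_le_sigmaMin_shift_add {n : ℕ} (hn : 1 ≤ n) (A : Matrix (Fin n) (Fin n) ℂ) (z : ℂ) :
    ‖z‖ ≤ sigmaMin (z • (1 : Matrix (Fin n) (Fin n) ℂ) - A) + norm2 A := by
  obtain ⟨v, hv, hv'⟩ := exists_norm_eq_sigmaMin hn (z • (1 : Matrix (Fin n) (Fin n) ℂ) - A)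
  have h1 : z • v = Matrix.toEuclideanLin (z • (1 : Matrix (Fin n) (Fin n) ℂ) - A) v
      + Matrix.toEuclideanLin A v := by
    rw [← LinearMap.add_apply, ← map_add, sub_add_cancel, map_smul, LinearMap.smul_apply]
    congr 1
    exact (congrArg (fun R => R v) (map_one (Matrix.toEuclideanCLM (n := Fin n) (𝕜 := ℂ)))).symm
  have h2 := norm_toEuclideanLin_le A v
  rw [hv, mul_one] at h2
  calc ‖z‖ = ‖z • v‖ := by rw [norm_smul, hv, mul_one]
    _ ≤ _ := by rw [h1, ← hv']; exact (norm_add_le _ _).trans (by gcongr)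

/-! ### The function `g` and the Kreiss constant -/

theorem kreissFun_eq {n : ℕ} (hn : 1 ≤ n) (A : Matrix (Fin n) (Fin n) ℂ) {x : ℝ} (hx : 0 < x)
    (y : ℝ) : kreissFun A x y =
      sigmaMin (((x : ℂ) + Complex.I * (y : ℂ)) • (1 : Matrix (Fin n) (Fin n) ℂ) - A) / x := by
  rw [kreissFun, kreissG, sigmaMin_smul hn (by simpa using hx.ne')]
  simp [abs_of_pos hx, inv_mul_eq_div]

/-- `g(x, ·)` is Lipschitz with constant `1 / x`. -/
theorem kreissFun_le_add {n : ℕ} (hn : 1 ≤ n) (A : Matrix (Fin n) (Fin n) ℂ) {x : ℝ} (hx : 0 < x)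
    (y y' : ℝ) : kreissFun A x y ≤ kreissFun A x y' + |y - y'| / x := by
  rw [kreissFun_eq hn A hx, kreissFun_eq hn A hx, ← add_div]
  gcongr
  refine (sigmaMin_shift_le hn A _ ((x : ℂ) + Complex.I * (y' : ℂ))).trans_eq ?_
  rw [add_sub_add_left_eq_sub, ← mul_sub, norm_mul, Complex.norm_I, one_mul, ← Complex.ofReal_sub,
    Complex.norm_real, Real.norm_eq_abs]

/-- Where `g ≤ γ < 1`, the bound `|z| ≤ σ_min(zI - A) + ‖A‖ ≤ γ x + ‖A‖` with `x ≤ |z|` makes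
`x ≤ ‖A‖ / (1 - γ)` and then `|y|` bounded. -/
theorem isCompact_kreissFun_le {n : ℕ} (hn : 1 ≤ n) (A : Matrix (Fin n) (Fin n) ℂ) {γ : ℝ}
    (hγ0 : 0 ≤ γ) (hγ1 : γ < 1) (hc : Continuous fun p : ℝ × ℝ => kreissFun A (Real.exp p.1) p.2)
    (a : ℝ) : IsCompact
      ({p : ℝ × ℝ | a ≤ p.1} ∩ {p | kreissFun A (Real.exp p.1) p.2 - γ ≤ 0}) := by
  set R := norm2 A / (1 - γ)
  set Y := γ * R + norm2 A
  refine (isCompact_Icc.prod isCompact_Icc :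
    IsCompact (Set.Icc a R ×ˢ Set.Icc (-Y) Y)).of_isClosed_subset ?_ ?_
  · exact (isClosed_le continuous_const continuous_fst).inter
      (isClosed_le (hc.sub continuous_const) continuous_const)
  · rintro ⟨t, y⟩ ⟨hat, hty⟩
    simp only [Set.mem_ofPred_eq] at hat hty
    rw [kreissFun_eq hn A (Real.exp_pos t), sub_nonpos, div_le_iff₀ (Real.exp_pos t)] at hty
    set z : ℂ := (Real.exp t : ℂ) + Complex.I * (y : ℂ) with hz
    have hre : z.re = Real.exp t := by simp [hz, -Complex.ofReal_exp]
    have him : z.im = y := by simp [hz]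
    have hnorm : ‖z‖ ≤ γ * Real.exp t + norm2 A :=
      (norm_le_sigmaMin_shift_add hn A z).trans (by gcongr)
    have hexp : Real.exp t ≤ R := by
      rw [le_div_iff₀ (by linarith)]
      have := (Complex.re_le_norm z).trans hnorm
      rw [hre] at this
      linarith
    have hy : |y| ≤ Y := by
      rw [← him]
      refine (Complex.abs_im_le_norm z).trans (hnorm.trans ?_)
      simp only [Y]
      gcongr
    exact ⟨⟨hat, by linarith [Real.add_one_le_exp t]⟩, abs_le.1 hy⟩

/-- Continuity of `g` in the coordinates `x = exp t`, which turn the half-plane into the whole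
plane and keep vertical translations. -/
theorem continuous_kreissFun_exp {n : ℕ} (hn : 1 ≤ n) (A : Matrix (Fin n) (Fin n) ℂ) :
    Continuous fun p : ℝ × ℝ => kreissFun A (Real.exp p.1) p.2 := by
  simp_rw [fun p : ℝ × ℝ => kreissFun_eq hn A (Real.exp_pos p.1) p.2]
  refine Continuous.div ?_ (by fun_prop) fun p => (Real.exp_pos _).ne'
  exact (continuous_sigmaMin_shift hn A).comp (by fun_prop)

/-- Since `x ‖(zI - A)⁻¹‖ = 1 / g(x, y)`, a minimizer of `g` attains the supremum in the Kreiss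
constant. -/
theorem kreissConst_inv_eq {n : ℕ} (hn : 1 ≤ n) {A : Matrix (Fin n) (Fin n) ℂ}
    (hA : spectralAbscissa A < 0) {xs ys : ℝ} (hmin : IsGlobalKreissMinimizer A xs ys) :
    (kreissConst A)⁻¹ = kreissFun A xs ys := by
  have hpos : ∀ x y : ℝ, 0 < x → 0 < kreissFun A x y ∧
      x * norm2 ((((x : ℂ) + Complex.I * (y : ℂ)) • (1 : Matrix (Fin n) (Fin n) ℂ) - A)⁻¹) =
        (kreissFun A x y)⁻¹ := by
    intro x y hx
    obtain ⟨h1, h2⟩ := sigmaMin_pos_and_norm2_inv hn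
      (isUnit_smul_one_sub hA (z := (x : ℂ) + Complex.I * (y : ℂ)) (by simpa using hx))
    rw [kreissFun_eq hn A hx, h2, inv_div, div_eq_mul_inv]
    exact ⟨div_pos h1 hx, rfl⟩
  have : IsGreatest ((fun z : ℂ => z.re * norm2 ((z • (1 : Matrix (Fin n) (Fin n) ℂ) - A)⁻¹)) ''
      {z : ℂ | 0 < z.re}) (kreissFun A xs ys)⁻¹ := by
    constructor
    · refine ⟨(xs : ℂ) + Complex.I * (ys : ℂ), by simpa using hmin.1, ?_⟩
      rw [← (hpos xs ys hmin.1).2]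
      simp
    · rintro _ ⟨z, hz, rfl⟩
      have h := (hpos z.re z.im hz).2
      rw [mul_comm Complex.I, Complex.re_add_im] at h
      simp only [h]
      exact inv_anti₀ (hpos _ _ hmin.1).1 (hmin.2 _ _ hz)
  rw [kreissConst, this.csSup_eq, inv_inv]

theorem theorem4p1 (n : ℕ) (hn : 1 ≤ n) (A : Matrix (Fin n) (Fin n) ℂ)
    (hA : spectralAbscissa A < 0) (γ : ℝ) (hγ : γ ∈ Set.Ico (0 : ℝ) 1) (η : ℝ) (hη : 0 ≤ η)
    (xs ys : ℝ) (hmin : IsGlobalKreissMinimizer A xs ys) :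
    ((kreissConst A)⁻¹ ≤ γ → η ≤ 2 * xs * (γ - (kreissConst A)⁻¹) →
      ∃ x y : ℝ, 0 < x ∧ kreissFun A x y = γ ∧ kreissFun A x (y + η) = γ) ∧
    ((¬ ∃ x y : ℝ, 0 < x ∧ kreissFun A x y = γ ∧ kreissFun A x (y + η) = γ) →
      (kreissConst A)⁻¹ > γ - η / (2 * xs)) := by
  have hxs : 0 < xs := hmin.1
  have key : (kreissConst A)⁻¹ ≤ γ - η / (2 * xs) →
      ∃ x y : ℝ, 0 < x ∧ kreissFun A x y = γ ∧ kreissFun A x (y + η) = γ := by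
    intro h
    rw [kreissConst_inv_eq hn hA hmin] at h
    have hc := continuous_kreissFun_exp hn A
    -- `g(xs, ·)` is `1 / xs`-Lipschitz, so it stays `≤ γ` within distance `η / 2` of `ys`.
    have hseg : ∀ s ∈ Set.Icc (ys - η / 2) (ys - η / 2 + η),
        kreissFun A (Real.exp (Real.log xs)) s - γ ≤ 0 := by
      rintro s ⟨hs1, hs2⟩
      rw [Real.exp_log hxs]
      have h3 : |s - ys| / xs ≤ (η / 2) / xs := by
        gcongr
        exact abs_le.2 ⟨by linarith, by linarith⟩
      rw [div_div] at h3
      linarith [kreissFun_le_add hn A hxs s ys]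
    obtain ⟨t, y, h1, h2⟩ := exists_vertical_chord
      (f := fun p : ℝ × ℝ => kreissFun A (Real.exp p.1) p.2 - γ) (hc.sub continuous_const)
      (isCompact_kreissFun_le hn A hγ.1 hγ.2 hc) hη hseg
    exact ⟨Real.exp t, y, Real.exp_pos t, sub_eq_zero.1 h1, sub_eq_zero.1 h2⟩
  refine ⟨fun _ h => key ?_, fun h => not_le.1 fun h' => h (key h')⟩
  rw [le_sub_comm, div_le_iff₀ (by positivity)]
  linarith
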